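/- Rings are associative with unity, modules are left modules, and complexes are indexed homologically. **Definitions.** Let $R$ be a ring. A complex $P$ of $R$-modules is DG-projective if every $P_i$ is projective and $\mathrm{Hom}_R(P,E)$ is exact for every exact complex $E$. A complex $T$ of $R$-modules is totally $\mathcal F$-acyclic if every $T_i$ is projective, $T$ is exact, and $\mathrm{Hom}_R(T,F)$ is exact for every flat $R$-module $F$. An $\mathcal F$-complete resolution of an $R$-complex $X$ is a diagram of morphisms of complexes $T\xrightarrow{\tau}P\xrightarrow{\pi}X$, where $P$ is DG-projective, $\pi$ is a quasi-isomorphism, $T$ is totally $\mathcal F$-acyclic, and $\tau_i$ is bijective for all $i\gg 0$. The Ding projective dimension of $X$ is $$\mathrm{Dpd}_R(X)=\inf\{\,n\in\mathbb Z : \text{there is an } \mathcal F\text{-complete resolution } T\xrightarrow{\tau}P\xrightarrow{\pi}X \text{ with } \tau_i \text{ bijective for all } i\ge n\,\}\in\{-\infty\}\cup\mathbb Z\cup\{\infty\},$$ where $\inf\emptyset=\infty$. The complex $X$ is homologically bounded below if $H_n(X)=0$ for all $n\ll 0$. Let $R$ be a subring of a ring $S$ with the same unity $1$. Then $S$ is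 an excellent extension of $R$ if (A) there is a finite subset $\{a_1,\dots,a_n\}$ of $S$ with $a_1=1$ and $a_iR=Ra_i$ for all $i$, such that $S$ is free with basis $\{a_1,\dots,a_n\}$ both as a right and as a left $R$-module; and (B) whenever $N$ is an $S$-submodule of a left $S$-module $M$ and $N$ is a direct summand of $M$ as an $R$-module, then $N$ is a direct summand of $M$ as an $S$-module. Let $\mathbf{R}\mathrm{Hom}_R(S,-)$ and $S\otimes^{\mathbf L}_R-$, from the derived category of $R$ to the derived category of $S$, denote the total right derived functor of $\mathrm{Hom}_R(S,-)$ and the total left derived functor of $S\otimes_R-$, respectively. **Corollary.** Let $S$ be an excellent extension of $R$ and let $X$ be a homologically bounded below complex of $R$-modules. Then $\mathbf{R}\mathrm{Hom}_R(S,X)$ and $S\otimes^{\mathbf L}_R X$ exist, and 1. $\mathrm{Dpd}_S(\mathbf{R}\mathrm{Hom}_R(S,X))\le \mathrm{Dpd}_R(X)$; 2. $\mathrm{Dpd}_S(S\otimes^{\mathbf L}_R X)\le \mathrm{Dpd}_R(X)$. Here the left-hand sides are taken at any $S$-complex representing the indicated object of the derived category of $S$. -/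

import Mathlib

open CategoryTheory TensorProduct

universe w₁ w₂ u

/-! ### Excellent extensions -/

/-- `S` is an excellent extension of `R` along the inclusion `φ : R →+* S` of a unital subring. -/
structure IsExcellentExtension {R S : Type u} [Ring R] [Ring S] (φ : R →+* S) : Prop where
  injective : Function.Injective φ
  /-- `S` is a free normalizing extension with a finite basis `a₀ = 1, a₁, …, aₙ`: each
  `aᵢ R = R aᵢ`, and `(aᵢ)` is a basis of `S` both as a right and as a left `R`-module. -/
  free_normalizing : ∃ (n : ℕ) (a : Fin (n + 1) → S), a 0 = 1 ∧
    (∀ i, Set.range (fun r : R => a i * φ r) = Set.range (fun r : R => φ r * a i)) ∧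
    (∀ s : S, ∃! c : Fin (n + 1) → R, ∑ i, a i * φ (c i) = s) ∧
    (∀ s : S, ∃! c : Fin (n + 1) → R, ∑ i, φ (c i) * a i = s)
  /-- `S` is `R`-projective: an `S`-submodule of a left `S`-module that has an `R`-module
  complement has an `S`-module complement. -/
  relatively_projective : ∀ (M : Type u) [AddCommGroup M] [Module S M] (N : Submodule S M),
    (∃ K : AddSubgroup M, (∀ (r : R), ∀ x ∈ K, φ r • x ∈ K) ∧ IsCompl N.toAddSubgroup K) →
      ∃ L : Submodule S M, IsCompl N L

/-! ### Tensor products and flatness over a noncommutative ring -/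

section Flat

variable (R : Type u) [Ring R]

/-- The relations `a r ⊗ m - a ⊗ r m` defining `A ⊗_R M` as a quotient of `A ⊗_ℤ M`, for a right
`R`-module `A` (that is, an `Rᵐᵒᵖ`-module) and a left `R`-module `M`. -/
def balancedRel (A M : Type u) [AddCommGroup A] [Module Rᵐᵒᵖ A] [AddCommGroup M] [Module R M] :
    AddSubgroup (A ⊗[ℤ] M) :=
  AddSubgroup.closure {x | ∃ (a : A) (r : R) (m : M),
    x = (MulOpposite.op r • a) ⊗ₜ[ℤ] m - a ⊗ₜ[ℤ] (r • m)}

/-- The abelian group `A ⊗_R M`. -/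
abbrev BalancedTensor (A M : Type u) [AddCommGroup A] [Module Rᵐᵒᵖ A] [AddCommGroup M]
    [Module R M] : Type u :=
  (A ⊗[ℤ] M) ⧸ balancedRel R A M

/-- The map `f ⊗_R M : A ⊗_R M → B ⊗_R M`. -/
def BalancedTensor.map {A B : Type u} (M : Type u) [AddCommGroup A] [Module Rᵐᵒᵖ A]
    [AddCommGroup B] [Module Rᵐᵒᵖ B] [AddCommGroup M] [Module R M] (f : A →ₗ[Rᵐᵒᵖ] B) :
    BalancedTensor R A M →+ BalancedTensor R B M :=
  QuotientAddGroup.map _ _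
    (LinearMap.rTensor M f.toAddMonoidHom.toIntLinearMap).toAddMonoidHom (by
      rw [balancedRel, AddSubgroup.closure_le]
      rintro _ ⟨a, r, m, rfl⟩
      refine AddSubgroup.subset_closure ⟨f a, r, m, ?_⟩
      simp [map_sub])

/-- A left `R`-module `M` is flat if `- ⊗_R M` preserves injections of right `R`-modules. -/
def IsFlatModule (M : Type u) [AddCommGroup M] [Module R M] : Prop :=
  ∀ (A B : Type u) [AddCommGroup A] [Module Rᵐᵒᵖ A] [AddCommGroup B] [Module Rᵐᵒᵖ B]
    (f : A →ₗ[Rᵐᵒᵖ] B), Function.Injective f → Function.Injective (BalancedTensor.map R M f)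

end Flat

/-! ### The functors `S ⊗_R -` and `Hom_R(S, -)` from left `R`-modules to left `S`-modules -/

section ChangeOfRings

variable {R S : Type u} [Ring R] [Ring S] (φ : R →+* S)

/-- The relations `s φ(r) ⊗ m - s ⊗ r m` defining `S ⊗_R M` as a quotient of the left `S`-module
`S ⊗_ℤ M`. -/
def extensionRel (M : Type u) [AddCommGroup M] [Module R M] : Submodule S (S ⊗[ℤ] M) :=
  Submodule.span S {x | ∃ (s : S) (r : R) (m : M),
    x = (s * φ r) ⊗ₜ[ℤ] m - s ⊗ₜ[ℤ] (r • m)}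

/-- The `S`-linear map `S ⊗_R f`. -/
noncomputable def extensionMap {M N : Type u} [AddCommGroup M] [Module R M] [AddCommGroup N]
    [Module R N] (f : M →ₗ[R] N) :
    ((S ⊗[ℤ] M) ⧸ extensionRel φ M) →ₗ[S] ((S ⊗[ℤ] N) ⧸ extensionRel φ N) :=
  Submodule.mapQ _ _ (TensorProduct.AlgebraTensorModule.map (LinearMap.id : S →ₗ[S] S)
    f.toAddMonoidHom.toIntLinearMap) (by
      rw [extensionRel, Submodule.span_le]
      rintro _ ⟨s, r, m, rfl⟩
      refine Submodule.subset_span ⟨s, r, f m, ?_⟩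
      simp [map_sub])

/-- The class of `s ⊗ m` in `S ⊗_R M`. -/
def extensionTmul {M : Type u} [AddCommGroup M] [Module R M] (s : S) (m : M) :
    (S ⊗[ℤ] M) ⧸ extensionRel φ M :=
  Submodule.Quotient.mk (s ⊗ₜ[ℤ] m)

theorem extensionTensor_hom_ext {M : Type u} [AddCommGroup M] [Module R M] {N : Type u}
    [AddCommGroup N] [Module S N] {f g : ((S ⊗[ℤ] M) ⧸ extensionRel φ M) →ₗ[S] N}
    (h : ∀ (s : S) (m : M), f (extensionTmul φ s m) = g (extensionTmul φ s m)) : f = g := by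
  refine LinearMap.ext fun x => ?_
  obtain ⟨x, rfl⟩ := Submodule.Quotient.mk_surjective _ x
  induction x using TensorProduct.induction_on with
  | zero => simp
  | tmul s m => exact h s m
  | add x y hx hy => rw [Submodule.Quotient.mk_add, map_add, map_add, hx, hy]

theorem extensionMap_tmul {M N : Type u} [AddCommGroup M] [Module R M] [AddCommGroup N]
    [Module R N] (f : M →ₗ[R] N) (s : S) (m : M) :
    extensionMap φ f (extensionTmul φ s m) = extensionTmul φ s (f m) :=
  rfl

/-- The functor `S ⊗_R -`. -/
noncomputable def extensionFunctor : ModuleCat.{u} R ⥤ ModuleCat.{u} S where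
  obj M := ModuleCat.of S ((S ⊗[ℤ] M) ⧸ extensionRel φ M)
  map f := ModuleCat.ofHom (extensionMap φ f.hom)
  map_id _ := ModuleCat.hom_ext (extensionTensor_hom_ext φ fun _ _ => rfl)
  map_comp _ _ := ModuleCat.hom_ext (extensionTensor_hom_ext φ fun _ _ => rfl)

instance extensionFunctor_additive : (extensionFunctor φ).Additive where
  map_add {_ _ f g} := ModuleCat.hom_ext (extensionTensor_hom_ext φ fun s m =>
    congrArg (Submodule.Quotient.mk (p := extensionRel φ _))
      (TensorProduct.tmul_add s (f.hom m) (g.hom m)))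

/-- `Hom_R(S, -)`, with `(s • g)(t) = g (t * s)`, is additive. -/
instance coextendScalars_additive_of_ring :
    (ModuleCat.coextendScalars.{u} φ : ModuleCat.{u} R ⥤ ModuleCat.{u} S).Additive where
  map_add {M N f g} := by
    ext x
    rfl

end ChangeOfRings

/-! ### Complexes and Ding projective dimension

An `R`-complex `… → X_{n+1} → X_n → X_{n-1} → …` is regarded as a cochain complex through the
usual relabelling `X_n = X^{-n}`; so the module in homological degree `n` is `X.X (-n)`. -/

section Ding

variable {R : Type u} [Ring R]

/-- `X` is homologically bounded below: `H_n(X) = 0` for all `n ≪ 0`. -/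
def IsHomologicallyBoundedBelow (X : CochainComplex (ModuleCat.{u} R) ℤ) : Prop :=
  ∃ b : ℤ, ∀ n : ℤ, n < b → X.ExactAt (-n)

/-- `P` is DG-projective: a complex of projective modules such that `Hom_R(P, E)` is exact for
every exact complex `E`, i.e. every morphism from `P` to an exact complex is null-homotopic (this
covers all degrees of `Hom_R(P, E)`, since the shifts of `E` are exact too). -/
def IsDGProjective (P : CochainComplex (ModuleCat.{u} R) ℤ) : Prop :=
  (∀ i : ℤ, Projective (P.X i)) ∧ P.IsKProjective

/-- `T` is totally `𝓕`-acyclic for the class `𝓕` of flat modules: an exact complex of projective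
modules such that `Hom_R(T, F)` is exact for every flat `R`-module `F`. -/
structure IsTotallyFAcyclic (T : CochainComplex (ModuleCat.{u} R) ℤ) : Prop where
  projective : ∀ i : ℤ, Projective (T.X i)
  exact : T.Acyclic
  hom_exact : ∀ F : ModuleCat.{u} R, IsFlatModule R F → ∀ i : ℤ,
    Function.Exact (fun g : T.X (i + 1) ⟶ F => T.d i (i + 1) ≫ g)
      (fun g : T.X i ⟶ F => T.d (i - 1) i ≫ g)

/-- There is an `𝓕`-complete resolution `T --τ--> P --π--> X` (`P` is DG-projective, `π` is a
quasi-isomorphism, `T` is totally `𝓕`-acyclic) with `τ_i` bijective for all `i ≥ n`. -/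
def HasFCompleteResolution (X : CochainComplex (ModuleCat.{u} R) ℤ) (n : ℤ) : Prop :=
  ∃ (T P : CochainComplex (ModuleCat.{u} R) ℤ) (τ : T ⟶ P) (π : P ⟶ X),
    IsTotallyFAcyclic T ∧ IsDGProjective P ∧ QuasiIso π ∧
      ∀ i : ℤ, n ≤ i → Function.Bijective (τ.f (-i))

/-- The Ding projective dimension of a complex, with values in `ℤ ∪ {-∞, ∞}`. -/
noncomputable def Dpd (X : CochainComplex (ModuleCat.{u} R) ℤ) : EReal :=
  sInf {e : EReal | ∃ n : ℤ, HasFCompleteResolution X n ∧ e = ((n : ℝ) : EReal)}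

end Ding

/-! ### `RHom_R(S, X)` and `S ⊗^L_R X` -/

section Derived

variable {R S : Type u} [Ring R] [Ring S] (φ : R →+* S)
  [HasDerivedCategory.{w₁} (ModuleCat.{u} R)] [HasDerivedCategory.{w₂} (ModuleCat.{u} S)]

/-- The `S`-complex `Y` represents `RHom_R(S, X)`: in the derived category of `S` it is isomorphic
to the value at `X` of the total right derived functor of `Hom_R(S, -)`. -/
def IsRHom (X : CochainComplex (ModuleCat.{u} R) ℤ) (Y : CochainComplex (ModuleCat.{u} S) ℤ) :
    Prop :=
  ∃ (RF : DerivedCategory (ModuleCat.{u} R) ⥤ DerivedCategory (ModuleCat.{u} S))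
    (α : (ModuleCat.coextendScalars.{u} φ).mapHomologicalComplex (ComplexShape.up ℤ) ⋙
      DerivedCategory.Q ⟶ DerivedCategory.Q ⋙ RF),
    RF.IsRightDerivedFunctor α (HomologicalComplex.quasiIso _ (ComplexShape.up ℤ)) ∧
      Nonempty (DerivedCategory.Q.obj Y ≅ RF.obj (DerivedCategory.Q.obj X))

/-- The `S`-complex `Y` represents `S ⊗^L_R X`: in the derived category of `S` it is isomorphic
to the value at `X` of the total left derived functor of `S ⊗_R -`. -/
def IsDerivedTensor (X : CochainComplex (ModuleCat.{u} R) ℤ)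
    (Y : CochainComplex (ModuleCat.{u} S) ℤ) : Prop :=
  ∃ (LF : DerivedCategory (ModuleCat.{u} R) ⥤ DerivedCategory (ModuleCat.{u} S))
    (α : DerivedCategory.Q ⋙ LF ⟶
      (extensionFunctor φ).mapHomologicalComplex (ComplexShape.up ℤ) ⋙ DerivedCategory.Q),
    LF.IsLeftDerivedFunctor α (HomologicalComplex.quasiIso _ (ComplexShape.up ℤ)) ∧
      Nonempty (DerivedCategory.Q.obj Y ≅ LF.obj (DerivedCategory.Q.obj X))

end Derived

/-! ### Relative projectivity -/

section RelativelyProjective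

variable {R S : Type u} [Ring R] [Ring S] {φ : R →+* S}

/-! Both `S ⊗_R -` and `Hom_R(S, -)` are exact because `S` is finite free over `R` on either side,
so they send quasi-isomorphisms to quasi-isomorphisms and their derived functors are computed
degreewise. Both are also left adjoints with exact right adjoints: restriction of scalars, and
`Hom_S(Hom_R(S, R), -)`. The second is exact because `Hom_R(S, R)` is projective over `S`: it is
free over `R` by the normalizing basis, and condition (B) lifts projectivity from `R` to `S`. Such
functors preserve projectives and DG-projective complexes.

It remains to see that they preserve totally `𝓕`-acyclic complexes. For `S ⊗_R -` this is the
adjunction together with flatness over `R` of a flat `S`-module (`IsFlatModule.restrict`). For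
`Hom_R(S, -)`, the relations `aᵢ r = σᵢ(r) aᵢ` split `Hom_R(S, T)` over `R` into twisted copies of
`T`; cocycles are extended copy by copy into twisted restrictions of `F`, and
`IsExcellentExtension.exists_extension` makes the resulting `R`-linear extension `S`-linear.

Hence an `𝓕`-complete resolution of `X` is carried to one of the image complex with the same bound
`n`, and DG-projectivity transfers it to any complex isomorphic to that image in the derived
category. -/

theorem IsExcellentExtension.exists_retraction (hφ : IsExcellentExtension φ)
    {M E : Type u} [AddCommGroup M] [Module S M] [AddCommGroup E] [Module S E]
    (i : M →ₗ[S] E) (ρ : E →+ M) (hρ : ∀ (r : R) (e : E), ρ (φ r • e) = φ r • ρ e)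
    (hi : ∀ m, ρ (i m) = m) : ∃ q : E →ₗ[S] M, q ∘ₗ i = LinearMap.id := by
  have hinj : Function.Injective i := Function.LeftInverse.injective hi
  -- The kernel of the `R`-linear retraction is an `R`-complement of the image of `i`; condition (B)
  -- upgrades it to an `S`-complement `L`, and projection along `L` is the new retraction.
  obtain ⟨L, hL⟩ := hφ.relatively_projective E (LinearMap.range i) ⟨ρ.ker, fun r x hx => by
    rw [AddMonoidHom.mem_ker] at hx ⊢
    rw [hρ, hx, smul_zero], by
    constructor
    · rw [AddSubgroup.disjoint_def]
      rintro _ ⟨m, rfl⟩ hm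
      have : m = 0 := by rw [← hi m]; exact hm
      rw [this, map_zero]
    · rw [codisjoint_iff, eq_top_iff]
      intro e _
      refine AddSubgroup.mem_sup.2 ⟨i (ρ e), ⟨ρ e, rfl⟩, e - i (ρ e), ?_, by abel⟩
      rw [AddMonoidHom.mem_ker, map_sub, hi, sub_self]⟩
  refine ⟨(LinearEquiv.ofInjective i hinj).symm.toLinearMap ∘ₗ
    Submodule.projectionOnto _ L hL, LinearMap.ext fun m => ?_⟩
  rw [LinearMap.comp_apply, LinearMap.comp_apply]
  have : i m = ((LinearEquiv.ofInjective i hinj m : LinearMap.range i) : E) := rfl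
  rw [this, Submodule.projectionOnto_apply_left]
  simp

/-- In the pushout of `d` and `g`, the `R`-linear extension `h` amounts to an `R`-linear retraction
onto `M`. An `S`-linear retraction then exists, and composing it with `V → pushout` gives `k`. -/
theorem IsExcellentExtension.exists_extension (hφ : IsExcellentExtension φ)
    {U V M : Type u} [AddCommGroup U] [Module S U] [AddCommGroup V] [Module S V]
    [AddCommGroup M] [Module S M] (d : U →ₗ[S] V) (g : U →ₗ[S] M) (h : V →+ M)
    (hh : ∀ (r : R) (v : V), h (φ r • v) = φ r • h v) (hd : ∀ x, h (d x) = g x) :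
    ∃ k : V →ₗ[S] M, k ∘ₗ d = g := by
  let W : Submodule S (M × V) := LinearMap.range (g.prod (-d))
  let ρ : ((M × V) ⧸ W) →+ M := QuotientAddGroup.lift W.toAddSubgroup
    ((AddMonoidHom.id M).coprod h) (by
      rintro _ ⟨x, rfl⟩
      simp [hd])
  obtain ⟨q, hq⟩ := hφ.exists_retraction (W.mkQ ∘ₗ LinearMap.inl S M V) ρ
    (by
      intro r e
      obtain ⟨⟨m, v⟩, rfl⟩ := W.mkQ_surjective e
      change φ r • m + h (φ r • v) = φ r • (m + h v)
      rw [hh, smul_add])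
    (by
      intro m
      change m + h 0 = m
      simp)
  refine ⟨q ∘ₗ W.mkQ ∘ₗ LinearMap.inr S M V, LinearMap.ext fun x => ?_⟩
  have h1 : W.mkQ (0, d x) = W.mkQ (g x, 0) := by
    rw [← sub_eq_zero, ← map_sub, Submodule.mkQ_apply, Submodule.Quotient.mk_eq_zero]
    exact ⟨-x, by simp⟩
  have h2 := LinearMap.congr_fun hq (g x)
  simp only [LinearMap.comp_apply, LinearMap.inl_apply, LinearMap.inr_apply, LinearMap.id_apply]
    at h2 ⊢
  rw [h1, h2]

/-- The canonical cover of `U` by a free `S`-module splits over `R`, so its kernel is an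
`R`-retract, hence an `S`-retract, and the cover splits over `S`. -/
theorem IsExcellentExtension.projective_of_restrict (hφ : IsExcellentExtension φ)
    {U : Type u} [AddCommGroup U] [Module S U] [Module R U]
    (hc : ∀ (r : R) (x : U), r • x = φ r • x)
    [Module.Projective R U] : Module.Projective S U := by
  let p : (U →₀ S) →ₗ[S] U := Finsupp.linearCombination S id
  have hp : Function.Surjective p := Finsupp.linearCombination_id_surjective S U
  let _ : Module R (U →₀ S) := Module.compHom _ φ
  let p' : (U →₀ S) →ₗ[R] U :=
    { toFun := p
      map_add' := map_add p
      map_smul' := fun r x => by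
        rw [RingHom.id_apply, hc]
        exact map_smul p (φ r) x }
  obtain ⟨s, hs⟩ := Module.projective_lifting_property p' LinearMap.id hp
  have hs' : ∀ x, p (s x) = x := fun x => LinearMap.congr_fun hs x
  have hmem : ∀ x, x - s (p x) ∈ LinearMap.ker p := fun x => by
    rw [LinearMap.mem_ker, map_sub, hs', sub_self]
  let ρ : (U →₀ S) →+ LinearMap.ker p :=
    { toFun := fun x => ⟨x - s (p x), hmem x⟩
      map_zero' := by simp
      map_add' := fun x y => Subtype.ext (by simp only [map_add, Submodule.coe_add]; abel) }
  obtain ⟨q, hq⟩ := hφ.exists_retraction (LinearMap.ker p).subtype ρ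
    (fun r e => Subtype.ext (by
      change φ r • e - s (p (φ r • e)) = φ r • (e - s (p e))
      rw [map_smul, ← hc, map_smul, smul_sub]
      rfl))
    (fun m => Subtype.ext (by
      change (m : U →₀ S) - s (p m) = m
      rw [LinearMap.mem_ker.1 m.2, map_zero, sub_zero]))
  have hq' : ∀ m : LinearMap.ker p, q m = m := fun m => LinearMap.congr_fun hq m
  -- The projector `1 - q` kills `ker p`, so it descends to an `S`-linear section of `p`.
  let t : (U →₀ S) →ₗ[S] (U →₀ S) := LinearMap.id - (LinearMap.ker p).subtype ∘ₗ q
  have ht : ∀ x, p x = 0 → t x = 0 := fun x hx => by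
    have := hq' ⟨x, hx⟩
    simp [t, this]
  let e : U →ₗ[S] (U →₀ S) :=
    ((LinearMap.ker p).liftQ t (fun x hx => ht x hx)) ∘ₗ
      (p.quotKerEquivOfSurjective hp).symm.toLinearMap
  refine Module.Projective.of_split e p (LinearMap.ext fun u => ?_)
  obtain ⟨x, rfl⟩ := hp u
  have : (p.quotKerEquivOfSurjective hp).symm (p x) = (LinearMap.ker p).mkQ x := by
    rw [LinearEquiv.symm_apply_eq]
    rfl
  have h0 : p (q x) = 0 := (q x).2
  rw [LinearMap.comp_apply, LinearMap.comp_apply, LinearEquiv.coe_coe, this]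
  change p (x - (q x : U →₀ S)) = p x
  rw [map_sub, h0, sub_zero]

end RelativelyProjective

/-! ### Exactness of `S ⊗_R -` and flatness of restricted modules -/

section Extension

variable {R S : Type u} [Ring R] [Ring S] (φ : R →+* S)

theorem extensionTmul_mul {M : Type u} [AddCommGroup M] [Module R M] (s : S) (r : R) (m : M) :
    extensionTmul φ (s * φ r) m = extensionTmul φ s (r • m) := by
  rw [extensionTmul, extensionTmul, ← sub_eq_zero, ← Submodule.Quotient.mk_sub,
    Submodule.Quotient.mk_eq_zero]
  exact Submodule.subset_span ⟨s, r, m, rfl⟩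

theorem extensionTmul_add {M : Type u} [AddCommGroup M] [Module R M] (s : S) (m m' : M) :
    extensionTmul φ s (m + m') = extensionTmul φ s m + extensionTmul φ s m' := by
  simp only [extensionTmul, TensorProduct.tmul_add, Submodule.Quotient.mk_add]

theorem extensionTmul_add_left {M : Type u} [AddCommGroup M] [Module R M] (s s' : S) (m : M) :
    extensionTmul φ (s + s') m = extensionTmul φ s m + extensionTmul φ s' m := by
  simp only [extensionTmul, TensorProduct.add_tmul, Submodule.Quotient.mk_add]

theorem extensionTmul_zero {M : Type u} [AddCommGroup M] [Module R M] (s : S) :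
    extensionTmul φ s (0 : M) = 0 := by
  simp only [extensionTmul, TensorProduct.tmul_zero, Submodule.Quotient.mk_zero]

theorem smul_extensionTmul {M : Type u} [AddCommGroup M] [Module R M] (t s : S) (m : M) :
    t • extensionTmul φ s m = extensionTmul φ (t * s) m :=
  rfl

@[elab_as_elim]
theorem extension_induction {M : Type u} [AddCommGroup M] [Module R M]
    {p : (S ⊗[ℤ] M) ⧸ extensionRel φ M → Prop} (x : (S ⊗[ℤ] M) ⧸ extensionRel φ M)
    (tmul : ∀ s m, p (extensionTmul φ s m)) (add : ∀ x y, p x → p y → p (x + y)) : p x := by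
  obtain ⟨x, rfl⟩ := Submodule.Quotient.mk_surjective _ x
  induction x using TensorProduct.induction_on with
  | zero => simpa [extensionTmul] using tmul 0 0
  | tmul s m => exact tmul s m
  | add x y hx hy => exact add _ _ hx hy

/-- The additive map out of `S ⊗_R M` induced by a balanced biadditive map. -/
noncomputable def extensionLift {M G : Type u} [AddCommGroup M] [Module R M] [AddCommGroup G]
    (b : S →+ M →+ G) (hb : ∀ s r m, b (s * φ r) m = b s (r • m)) :
    ((S ⊗[ℤ] M) ⧸ extensionRel φ M) →+ G :=
  QuotientAddGroup.lift (extensionRel φ M).toAddSubgroup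
    (TensorProduct.liftAddHom b (by
      intro z s m
      rw [map_zsmul, map_zsmul]
      rfl)) (by
    intro x hx
    rw [AddMonoidHom.mem_ker]
    -- The relations span over `S` but the map is only additive; quantifying over all multiples `t •
    -- x` lets the span induction pass through scalars.
    suffices h : ∀ t : S, TensorProduct.liftAddHom b (R := ℤ) (by
      intro z s m
      rw [map_zsmul, map_zsmul]
      rfl) (t • x) = 0 by simpa using h 1
    induction hx using Submodule.span_induction with
    | mem x hx =>
      obtain ⟨s, r, m, rfl⟩ := hx
      intro t
      rw [smul_sub, TensorProduct.smul_tmul', TensorProduct.smul_tmul', map_sub,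
        TensorProduct.liftAddHom_tmul, TensorProduct.liftAddHom_tmul, smul_eq_mul, smul_eq_mul,
        ← mul_assoc, hb, sub_self]
    | zero => simp
    | add x y _ _ hx hy =>
      intro t
      rw [smul_add, map_add, hx, hy, add_zero]
    | smul s x _ hx =>
      intro t
      rw [smul_smul]
      exact hx _)

theorem extensionLift_tmul {M G : Type u} [AddCommGroup M] [Module R M] [AddCommGroup G]
    (b : S →+ M →+ G) (hb : ∀ s r m, b (s * φ r) m = b s (r • m)) (s : S) (m : M) :
    extensionLift φ b hb (extensionTmul φ s m) = b s m :=
  rfl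

variable {φ}

/-- A right basis of `S` identifies `S ⊗_R M` with `M^ι`, and `S ⊗_R f` with `f` applied
coordinatewise. -/
theorem extensionMap_injective {ι : Type} [Fintype ι] (a : ι → S)
    (ha : ∀ s : S, ∃! c : ι → R, ∑ i, a i * φ (c i) = s)
    {M N : Type u} [AddCommGroup M] [Module R M] [AddCommGroup N] [Module R N] (f : M →ₗ[R] N)
    (hf : Function.Injective f) : Function.Injective (extensionMap φ f) := by
  classical
  choose c hc huniq using ha
  have huniq' : ∀ s d, ∑ i, a i * φ (d i) = s → d = c s := fun s d h => huniq s d h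
  have hadd : ∀ s t, c (s + t) = c s + c t := fun s t => (huniq' _ _ (by
    simp only [Pi.add_apply, map_add, mul_add, Finset.sum_add_distrib, hc])).symm
  have hmul : ∀ s r, c (s * φ r) = fun i => c s i * r := fun s r => (huniq' _ _ (by
    simp only [map_mul, ← mul_assoc, ← Finset.sum_mul, hc])).symm
  have hbasis : ∀ i, c (a i) = Pi.single i 1 := fun i => (huniq' _ _ (by
    rw [Finset.sum_eq_single i]
    · simp
    · intro j _ hj
      simp [hj]
    · simp)).symm
  -- Coordinates on `S ⊗_R N`: `s ⊗ m ↦ (cᵢ(s) m)ᵢ`. The `ULift` only places the target in `Type u`.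
  let β : S →+ N →+ (ULift.{u} ι → N) :=
    AddMonoidHom.mk' (fun s => AddMonoidHom.mk' (fun m i => c s i.down • m) (by
      intro x y
      funext i
      exact smul_add _ _ _)) (by
      intro s t
      ext m i
      change c (s + t) i.down • m = c s i.down • m + c t i.down • m
      rw [hadd, Pi.add_apply, add_smul])
  let Φ := extensionLift φ β (by
    intro s r m
    funext i
    change c (s * φ r) i.down • m = c s i.down • r • m
    rw [hmul, smul_smul])
  have hsum : ∀ x : (S ⊗[ℤ] M) ⧸ extensionRel φ M,
      ∃ m : ι → M, x = ∑ i, extensionTmul φ (a i) (m i) := by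
    intro x
    induction x using extension_induction with
    | tmul s m =>
      refine ⟨fun i => c s i • m, ?_⟩
      simp only [← extensionTmul_mul]
      conv_lhs => rw [← hc s]
      exact map_sum (AddMonoidHom.mk' (fun t => extensionTmul φ t m)
        (fun _ _ => extensionTmul_add_left φ _ _ _)) _ _
    | add x y hx hy =>
      obtain ⟨m, rfl⟩ := hx
      obtain ⟨m', rfl⟩ := hy
      refine ⟨m + m', ?_⟩
      simp only [Pi.add_apply, extensionTmul_add, Finset.sum_add_distrib]
  rw [injective_iff_map_eq_zero]
  intro x hx
  obtain ⟨m, rfl⟩ := hsum x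
  have h := congrArg Φ hx
  rw [map_sum, map_sum, map_zero] at h
  refine Finset.sum_eq_zero fun j _ => ?_
  have hj := congrFun h ⟨j⟩
  have key : ∀ i, Φ (extensionMap φ f (extensionTmul φ (a i) (m i))) ⟨j⟩ =
      (Pi.single i (1 : R) : ι → R) j • f (m i) := by
    intro i
    rw [← hbasis]
    rfl
  rw [Finset.sum_apply, Finset.sum_congr rfl fun i _ => key i, Finset.sum_eq_single j] at hj
  · rw [Pi.single_eq_same, one_smul] at hj
    rw [hf (hj.trans (map_zero f).symm), extensionTmul_zero]
  · intro i _ hij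
    rw [Pi.single_eq_of_ne hij.symm, zero_smul]
  · simp

/-- The class of `a ⊗ m` in `A ⊗_R M`. -/
def balancedTmul (R : Type u) [Ring R] {A M : Type u} [AddCommGroup A] [Module Rᵐᵒᵖ A]
    [AddCommGroup M] [Module R M] (a : A) (m : M) : BalancedTensor R A M :=
  QuotientAddGroup.mk (a ⊗ₜ[ℤ] m)

theorem balancedTmul_smul {A M : Type u} [AddCommGroup A] [Module Rᵐᵒᵖ A]
    [AddCommGroup M] [Module R M] (a : A) (r : R) (m : M) :
    balancedTmul R (MulOpposite.op r • a) m = balancedTmul R a (r • m) := by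
  rw [balancedTmul, balancedTmul, ← sub_eq_zero, ← QuotientAddGroup.mk_sub,
    QuotientAddGroup.eq_zero_iff]
  exact AddSubgroup.subset_closure ⟨a, r, m, rfl⟩

theorem balancedTmul_add {A M : Type u} [AddCommGroup A] [Module Rᵐᵒᵖ A]
    [AddCommGroup M] [Module R M] (a : A) (m m' : M) :
    balancedTmul R a (m + m') = balancedTmul R a m + balancedTmul R a m' := by
  simp only [balancedTmul, TensorProduct.tmul_add, QuotientAddGroup.mk_add]

theorem balancedTmul_add_left {A M : Type u} [AddCommGroup A] [Module Rᵐᵒᵖ A]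
    [AddCommGroup M] [Module R M] (a a' : A) (m : M) :
    balancedTmul R (a + a') m = balancedTmul R a m + balancedTmul R a' m := by
  simp only [balancedTmul, TensorProduct.add_tmul, QuotientAddGroup.mk_add]

/-- The additive map out of `A ⊗_R M` induced by a balanced biadditive map. -/
noncomputable def balancedLift {A M G : Type u} [AddCommGroup A] [Module Rᵐᵒᵖ A]
    [AddCommGroup M] [Module R M] [AddCommGroup G]
    (b : A →+ M →+ G) (hb : ∀ a (r : R) m, b (MulOpposite.op r • a) m = b a (r • m)) :
    BalancedTensor R A M →+ G :=
  QuotientAddGroup.lift (balancedRel R A M)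
    (TensorProduct.liftAddHom b (by
      intro z s m
      rw [map_zsmul, map_zsmul]
      rfl)) (by
    rw [balancedRel, AddSubgroup.closure_le]
    rintro _ ⟨a, r, m, rfl⟩
    change TensorProduct.liftAddHom b _ _ = 0
    rw [map_sub, TensorProduct.liftAddHom_tmul, TensorProduct.liftAddHom_tmul, hb, sub_self])

theorem balancedTensor_addHom_ext {A M G : Type u} [AddCommGroup A] [Module Rᵐᵒᵖ A]
    [AddCommGroup M] [Module R M] [AddCommGroup G] {f g : BalancedTensor R A M →+ G}
    (h : ∀ a m, f (balancedTmul R a m) = g (balancedTmul R a m)) : f = g := by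
  refine AddMonoidHom.ext fun x => ?_
  obtain ⟨x, rfl⟩ := QuotientAddGroup.mk_surjective x
  induction x using TensorProduct.induction_on with
  | zero => simp
  | tmul s m => exact h s m
  | add x y hx hy => rw [QuotientAddGroup.mk_add, map_add, map_add, hx, hy]

variable (φ)

/-- The map `A ⊗_R M → (A ⊗_R S) ⊗_S M`, `a ⊗ m ↦ (a ⊗ 1) ⊗ m`. -/
noncomputable def balancedToExtension (A M : Type u) [AddCommGroup A] [Module Rᵐᵒᵖ A]
    [AddCommGroup M] [Module R M] [Module S M] (hM : ∀ (r : R) (m : M), r • m = φ r • m) :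
    BalancedTensor R A M →+
      BalancedTensor S ((Sᵐᵒᵖ ⊗[ℤ] A) ⧸ extensionRel (RingHom.op φ) A) M :=
  balancedLift
    (AddMonoidHom.mk' (fun a => AddMonoidHom.mk'
      (fun m => balancedTmul S (extensionTmul (RingHom.op φ) 1 a) m) (balancedTmul_add _))
      (fun a a' => by
        ext m
        change balancedTmul S (extensionTmul (RingHom.op φ) 1 (a + a')) m = _
        rw [extensionTmul_add, balancedTmul_add_left]
        rfl))
    (fun a r m => by
      change balancedTmul S (extensionTmul (RingHom.op φ) 1 (MulOpposite.op r • a)) m =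
        balancedTmul S (extensionTmul (RingHom.op φ) 1 a) (r • m)
      rw [hM, ← balancedTmul_smul, ← extensionTmul_mul, smul_extensionTmul, one_mul, mul_one]
      rfl)

/-- The map `s ↦ a ↦ m ↦ a ⊗ s m` with values in `A ⊗_R M`. -/
noncomputable def balancedSMul (R S A M : Type u) [Ring R] [Ring S] [AddCommGroup A]
    [Module Rᵐᵒᵖ A] [AddCommGroup M] [Module R M] [Module S M] :
    Sᵐᵒᵖ →+ A →+ M →+ BalancedTensor R A M :=
  AddMonoidHom.mk' (fun s => AddMonoidHom.mk' (fun a => AddMonoidHom.mk'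
    (fun m : M => balancedTmul R a (s.unop • m))
    (fun m m' => by rw [smul_add, balancedTmul_add]))
    (fun a a' => AddMonoidHom.ext fun m => balancedTmul_add_left _ _ _))
    (fun s s' => AddMonoidHom.ext fun a => AddMonoidHom.ext fun m => by
      change balancedTmul R a ((s.unop + s'.unop) • m) = _
      rw [add_smul, balancedTmul_add]
      rfl)

theorem balancedSMul_apply {A M : Type u} [AddCommGroup A] [Module Rᵐᵒᵖ A]
    [AddCommGroup M] [Module R M] [Module S M] (s : Sᵐᵒᵖ) (a : A) (m : M) :
    balancedSMul R S A M s a m = balancedTmul R a (s.unop • m) :=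
  rfl

theorem balancedSMul_mul (A M : Type u) [AddCommGroup A] [Module Rᵐᵒᵖ A]
    [AddCommGroup M] [Module R M] [Module S M] (hM : ∀ (r : R) (m : M), r • m = φ r • m)
    (s : Sᵐᵒᵖ) (r : Rᵐᵒᵖ) (a : A) :
    balancedSMul R S A M (s * RingHom.op φ r) a = balancedSMul R S A M s (r • a) := by
  refine AddMonoidHom.ext fun m => ?_
  change balancedTmul R a ((φ r.unop * s.unop) • m) = balancedTmul R (r • a) (s.unop • m)
  rw [mul_smul, ← hM, ← balancedTmul_smul, MulOpposite.op_unop]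

theorem extensionLift_balancedSMul_smul (A M : Type u) [AddCommGroup A] [Module Rᵐᵒᵖ A]
    [AddCommGroup M] [Module R M] [Module S M] (hM : ∀ (r : R) (m : M), r • m = φ r • m)
    (x : (Sᵐᵒᵖ ⊗[ℤ] A) ⧸ extensionRel (RingHom.op φ) A) (s : S) (m : M) :
    extensionLift (RingHom.op φ) (balancedSMul R S A M) (balancedSMul_mul φ A M hM)
        (MulOpposite.op s • x) m =
      extensionLift (RingHom.op φ) (balancedSMul R S A M) (balancedSMul_mul φ A M hM)
        x (s • m) := by
  induction x using extension_induction with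
  | tmul t a =>
    rw [smul_extensionTmul, extensionLift_tmul, extensionLift_tmul, balancedSMul_apply,
      balancedSMul_apply, MulOpposite.unop_mul, MulOpposite.unop_op, mul_smul]
  | add x y hx hy =>
    rw [smul_add, map_add, map_add, AddMonoidHom.add_apply, AddMonoidHom.add_apply, hx, hy]

/-- The map `(A ⊗_R S) ⊗_S M → A ⊗_R M`, `(a ⊗ s) ⊗ m ↦ a ⊗ s m`. -/
noncomputable def balancedOfExtension (A M : Type u) [AddCommGroup A] [Module Rᵐᵒᵖ A]
    [AddCommGroup M] [Module R M] [Module S M] (hM : ∀ (r : R) (m : M), r • m = φ r • m) :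
    BalancedTensor S ((Sᵐᵒᵖ ⊗[ℤ] A) ⧸ extensionRel (RingHom.op φ) A) M →+
      BalancedTensor R A M :=
  balancedLift
    (extensionLift (RingHom.op φ) (balancedSMul R S A M) (balancedSMul_mul φ A M hM))
    (extensionLift_balancedSMul_smul φ A M hM)

variable {φ}

/-- The left basis makes `- ⊗_R S` preserve injections, and `A ⊗_R M` embeds naturally in `(A ⊗_R S)
⊗_S M` as a retract. Injectivity after tensoring over `S` therefore descends to `R`. -/
theorem IsFlatModule.restrict {ι : Type} [Fintype ι] (a : ι → S)
    (ha : ∀ s : S, ∃! c : ι → R, ∑ i, φ (c i) * a i = s)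
    {M : Type u} [AddCommGroup M] [Module R M] [Module S M]
    (hM : ∀ (r : R) (m : M), r • m = φ r • m) (h : IsFlatModule S M) : IsFlatModule R M := by
  intro A B _ _ _ _ f hf
  have hinj : Function.Injective (extensionMap (RingHom.op φ) f) := by
    -- `A ⊗_R S` is treated as an extension of scalars along `RingHom.op φ`; a left basis of `S` is
    -- a right basis of `Sᵐᵒᵖ`.
    refine extensionMap_injective (fun i => MulOpposite.op (a i)) (fun s => ?_) f hf
    obtain ⟨c, hc, hu⟩ := ha s.unop
    refine ⟨fun i => MulOpposite.op (c i), ?_, fun d hd => ?_⟩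
    · apply MulOpposite.unop_injective
      simpa [Finset.unop_sum] using hc
    · have := hu (fun i => (d i).unop) (by
        have := congrArg MulOpposite.unop hd
        simpa [Finset.unop_sum] using this)
      funext i
      exact congrArg MulOpposite.op (congrFun this i)
  have hM' := h _ _ (extensionMap (RingHom.op φ) f) hinj
  have h1 : (balancedOfExtension φ A M hM).comp (balancedToExtension φ A M hM) =
      AddMonoidHom.id _ := balancedTensor_addHom_ext fun a m => by
    change balancedTmul R a ((1 : S) • m) = balancedTmul R a m
    rw [one_smul]
  have h2 : (balancedToExtension φ B M hM).comp (BalancedTensor.map R M f) =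
      (BalancedTensor.map S M (extensionMap (RingHom.op φ) f)).comp
        (balancedToExtension φ A M hM) := balancedTensor_addHom_ext fun a m => rfl
  refine Function.Injective.of_comp (f := balancedToExtension φ B M hM) ?_
  have h3 := congrArg DFunLike.coe h2
  rw [AddMonoidHom.coe_comp, AddMonoidHom.coe_comp] at h3
  rw [h3]
  exact hM'.comp (Function.LeftInverse.injective (DFunLike.congr_fun h1))

end Extension

/-! ### Exact functors and left adjoints on complexes -/

section Adjoint

open CochainComplex

theorem CategoryTheory.Functor.acyclic_mapHomologicalComplex {C D : Type*} [Category C]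
    [Category D] [Abelian C] [Abelian D] (F : C ⥤ D) [F.Additive] [F.PreservesHomology]
    (K : CochainComplex C ℤ) (hK : K.Acyclic) :
    ((F.mapHomologicalComplex (ComplexShape.up ℤ)).obj K).Acyclic := fun i => by
  have h := hK i
  rw [HomologicalComplex.exactAt_iff] at h ⊢
  exact h.map F

/-- A map `F K ⟶ L` factors as `F` of its transpose `K ⟶ G L` followed by the counit. As `G L` is
acyclic, the transpose is null-homotopic, and so is the composite. -/
theorem CategoryTheory.Adjunction.isKProjective_mapHomologicalComplex {C D : Type*} [Category C]
    [Category D] [Abelian C] [Abelian D] {F : C ⥤ D} {G : D ⥤ C} (adj : F ⊣ G) [F.Additive]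
    [G.Additive] [G.PreservesHomology] (K : CochainComplex C ℤ) [K.IsKProjective] :
    IsKProjective ((F.mapHomologicalComplex (ComplexShape.up ℤ)).obj K) where
  nonempty_homotopy_zero {L} f hL := by
    let g : K ⟶ (G.mapHomologicalComplex (ComplexShape.up ℤ)).obj L :=
      { f := fun i => adj.homEquiv _ _ (f.f i)
        comm' := fun i j _ => (adj.homEquiv_naturality_right (f.f i) (L.d i j)).symm.trans
          ((congrArg (adj.homEquiv _ _) (f.comm i j)).trans
            (adj.homEquiv_naturality_left (K.d i j) (f.f j))) }
    let c : (F.mapHomologicalComplex (ComplexShape.up ℤ)).obj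
        ((G.mapHomologicalComplex (ComplexShape.up ℤ)).obj L) ⟶ L :=
      { f := fun i => adj.counit.app (L.X i)
        comm' := fun i j _ => (adj.counit.naturality (L.d i j)).symm }
    have hf : (F.mapHomologicalComplex (ComplexShape.up ℤ)).map g ≫ c = f := by
      ext i : 1
      exact (adj.homEquiv_counit _ _ _).symm.trans ((adj.homEquiv _ _).symm_apply_apply (f.f i))
    have h := F.mapHomotopy (IsKProjective.homotopyZero g (G.acyclic_mapHomologicalComplex L hL))
    refine ⟨(Homotopy.ofEq hf.symm).trans ((h.compRight c).trans (Homotopy.ofEq ?_))⟩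
    rw [Functor.map_zero, Limits.zero_comp]

theorem DerivedCategory.Q_map_surjective_of_isKProjective {C : Type*} [Category C] [Abelian C]
    [HasDerivedCategory C] (K L : CochainComplex C ℤ) [K.IsKProjective] (g : Q.obj K ⟶ Q.obj L) :
    ∃ f : K ⟶ L, Q.map f = g := by
  obtain ⟨h, hh⟩ := (IsKProjective.Qh_map_bijective K
    ((HomotopyCategory.quotient _ _).obj L)).surjective
    ((quotientCompQhIso C).hom.app K ≫ g ≫ (quotientCompQhIso C).inv.app L)
  obtain ⟨f, rfl⟩ := (HomotopyCategory.quotient C (ComplexShape.up ℤ)).map_surjective h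
  refine ⟨f, ?_⟩
  have h1 := (quotientCompQhIso C).hom.naturality f
  dsimp only [Functor.comp_map] at h1
  rw [hh, Category.assoc, Category.assoc, Iso.inv_hom_id_app, Category.comp_id] at h1
  exact ((cancel_epi _).1 h1).symm

end Adjoint

/-! ### Transport of `𝓕`-complete resolutions -/

section Resolution

/-- Since `P` is K-projective, the composite `P → X ≅ Y` in the derived category comes from a chain
map, necessarily a quasi-isomorphism; `T` and `τ` stay the same. -/
theorem HasFCompleteResolution.of_iso {R : Type u} [Ring R]
    [HasDerivedCategory.{w₁} (ModuleCat.{u} R)] {X Y : CochainComplex (ModuleCat.{u} R) ℤ}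
    (e : DerivedCategory.Q.obj X ≅ DerivedCategory.Q.obj Y) {n : ℤ}
    (h : HasFCompleteResolution X n) : HasFCompleteResolution Y n := by
  obtain ⟨T, P, τ, π, hT, hP, hπ, hτ⟩ := h
  have := hP.2
  obtain ⟨f, hf⟩ := DerivedCategory.Q_map_surjective_of_isKProjective P Y
    (DerivedCategory.Q.map π ≫ e.hom)
  refine ⟨T, P, τ, f, hT, hP, ?_, hτ⟩
  rw [← DerivedCategory.isIso_Q_map_iff_quasiIso, hf]
  infer_instance

theorem HasFCompleteResolution.mapHomologicalComplex {R S : Type u} [Ring R] [Ring S]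
    {F : ModuleCat.{u} R ⥤ ModuleCat.{u} S} {G : ModuleCat.{u} S ⥤ ModuleCat.{u} R} (adj : F ⊣ G)
    [F.Additive] [F.PreservesHomology] [G.Additive] [G.PreservesHomology]
    (hF : ∀ T, IsTotallyFAcyclic T →
      IsTotallyFAcyclic ((F.mapHomologicalComplex (ComplexShape.up ℤ)).obj T))
    {X : CochainComplex (ModuleCat.{u} R) ℤ} {n : ℤ} (h : HasFCompleteResolution X n) :
    HasFCompleteResolution ((F.mapHomologicalComplex (ComplexShape.up ℤ)).obj X) n := by
  obtain ⟨T, P, τ, π, hT, hP, hπ, hτ⟩ := h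
  have := hP.2
  refine ⟨_, _, (F.mapHomologicalComplex _).map τ, (F.mapHomologicalComplex _).map π, hF T hT,
    ⟨fun i => adj.map_projective _ (hP.1 i), adj.isKProjective_mapHomologicalComplex P⟩,
    inferInstance, fun i hi => ?_⟩
  have := (ConcreteCategory.isIso_iff_bijective _).2 (hτ i hi)
  exact (ConcreteCategory.isIso_iff_bijective (F.map (τ.f (-i)))).1 inferInstance

theorem Dpd_le_of_hasFCompleteResolution {R S : Type u} [Ring R] [Ring S]
    {X : CochainComplex (ModuleCat.{u} R) ℤ} {Y : CochainComplex (ModuleCat.{u} S) ℤ}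
    (h : ∀ n, HasFCompleteResolution X n → HasFCompleteResolution Y n) : Dpd Y ≤ Dpd X :=
  sInf_le_sInf fun _ ⟨n, hn, he⟩ => ⟨n, h n hn, he⟩

end Resolution

/-! ### Derived functors of exact functors -/

section Derived

theorem isInvertedBy_mapHomologicalComplex_Q {R S : Type u} [Ring R] [Ring S]
    [HasDerivedCategory.{w₂} (ModuleCat.{u} S)]
    (F : ModuleCat.{u} R ⥤ ModuleCat.{u} S) [F.Additive] [F.PreservesHomology] :
    (HomologicalComplex.quasiIso (ModuleCat.{u} R) (ComplexShape.up ℤ)).IsInvertedBy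
      (F.mapHomologicalComplex (ComplexShape.up ℤ) ⋙ DerivedCategory.Q) := fun K L f hf => by
  have : QuasiIso f := hf
  dsimp only [Functor.comp_map]
  infer_instance

variable {R S : Type u} [Ring R] [Ring S] (φ : R →+* S)
  [HasDerivedCategory.{w₁} (ModuleCat.{u} R)] [HasDerivedCategory.{w₂} (ModuleCat.{u} S)]

/-- An exact functor applied degreewise already inverts quasi-isomorphisms, so it factors through
the derived category and the structure map `α` of any derived functor is invertible. -/
theorem isRHom_iff [(ModuleCat.coextendScalars.{u} φ :
      ModuleCat.{u} R ⥤ ModuleCat.{u} S).PreservesHomology]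
    (X : CochainComplex (ModuleCat.{u} R) ℤ) (Y : CochainComplex (ModuleCat.{u} S) ℤ) :
    IsRHom φ X Y ↔ Nonempty (DerivedCategory.Q.obj Y ≅ DerivedCategory.Q.obj
      (((ModuleCat.coextendScalars.{u} φ).mapHomologicalComplex (ComplexShape.up ℤ)).obj X)) := by
  have hF := isInvertedBy_mapHomologicalComplex_Q (ModuleCat.coextendScalars.{u} φ :
    ModuleCat.{u} R ⥤ ModuleCat.{u} S)
  constructor
  · rintro ⟨RF, α, hα, ⟨e⟩⟩
    have := Functor.isIso_of_isRightDerivedFunctor_of_inverts RF α hF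
    exact ⟨e ≪≫ (asIso (α.app X)).symm⟩
  · rintro ⟨e⟩
    exact ⟨Localization.lift _ hF DerivedCategory.Q, (Localization.fac _ hF _).inv, inferInstance,
      ⟨e ≪≫ (Localization.fac _ hF DerivedCategory.Q).symm.app X⟩⟩

theorem isDerivedTensor_iff [(extensionFunctor φ).PreservesHomology]
    (X : CochainComplex (ModuleCat.{u} R) ℤ) (Y : CochainComplex (ModuleCat.{u} S) ℤ) :
    IsDerivedTensor φ X Y ↔ Nonempty (DerivedCategory.Q.obj Y ≅ DerivedCategory.Q.obj
      (((extensionFunctor φ).mapHomologicalComplex (ComplexShape.up ℤ)).obj X)) := by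
  have hF := isInvertedBy_mapHomologicalComplex_Q (extensionFunctor φ)
  constructor
  · rintro ⟨LF, α, hα, ⟨e⟩⟩
    have := Functor.isIso_of_isLeftDerivedFunctor_of_inverts LF α hF
    exact ⟨e ≪≫ asIso (α.app X)⟩
  · rintro ⟨e⟩
    exact ⟨Localization.lift _ hF DerivedCategory.Q, (Localization.fac _ hF _).hom, inferInstance,
      ⟨e ≪≫ (Localization.fac _ hF DerivedCategory.Q).symm.app X⟩⟩

end Derived

/-! ### Adjunctions -/

section Adjunctions

variable {R S : Type u} [Ring R] [Ring S] (φ : R →+* S)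

instance restrictScalars_preservesHomology {A B : Type u} [Ring A] [Ring B] (f : A →+* B) :
    (ModuleCat.restrictScalars.{u} f).PreservesHomology := by
  refine ((Functor.exact_tfae (ModuleCat.restrictScalars.{u} f)).out 1 2).1 fun K hK => ?_
  rw [ShortComplex.moduleCat_exact_iff] at hK ⊢
  exact hK

/-- The `S`-linear map `S ⊗_R M → N` induced by an `R`-linear map `M → N`. -/
noncomputable def extensionDesc {M : ModuleCat.{u} R} {N : ModuleCat.{u} S}
    (g : M ⟶ (ModuleCat.restrictScalars φ).obj N) : (extensionFunctor φ).obj M ⟶ N :=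
  let b : S →+ M →+ N := AddMonoidHom.mk'
    (fun s => AddMonoidHom.mk' (fun m => s • (show N from g m)) (fun m m' => by
      rw [map_add]; exact smul_add _ _ _))
    (fun s s' => AddMonoidHom.ext fun m => add_smul _ _ _)
  have hb : ∀ s r m, b (s * φ r) m = b s (r • m) := fun s r m => by
    change (s * φ r) • (show N from g m) = s • (show N from g (r • m))
    rw [map_smul, mul_smul]
    rfl
  ModuleCat.ofHom
    { extensionLift φ b hb with
      map_smul' := fun t x => by
        change extensionLift φ b hb (t • x) = t • extensionLift φ b hb x
        induction x using extension_induction with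
        | tmul s m => exact mul_smul t s (show N from g m)
        | add x y hx hy => rw [smul_add, map_add, map_add, hx, hy, smul_add] }

/-- `S ⊗_R -` is left adjoint to restriction of scalars. -/
noncomputable def extensionAdjunction :
    extensionFunctor φ ⊣ ModuleCat.restrictScalars.{u} φ :=
  Adjunction.mkOfHomEquiv
    { homEquiv := fun M N =>
        { toFun := fun f => ModuleCat.ofHom (Y := (ModuleCat.restrictScalars φ).obj N)
            { toFun := fun m => f (extensionTmul φ 1 m)
              map_add' := fun m m' => by
                rw [extensionTmul_add]
                exact map_add f.hom _ _
              map_smul' := fun r m => by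
                rw [← extensionTmul_mul, one_mul, ← mul_one (φ r), ← smul_extensionTmul]
                exact map_smul f.hom _ _ }
          invFun := extensionDesc φ
          left_inv := fun f => ModuleCat.hom_ext (extensionTensor_hom_ext φ fun s m => by
            change s • f.hom (extensionTmul φ 1 m) = _
            refine (f.hom.map_smul s _).symm.trans ?_
            change f.hom (extensionTmul φ (s * 1) m) = _
            rw [mul_one]
            rfl)
          right_inv := fun g => by
            ext m
            exact one_smul S (show N from g m) }
      homEquiv_naturality_left_symm := fun f g =>
        ModuleCat.hom_ext (extensionTensor_hom_ext φ fun s m => rfl)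
      homEquiv_naturality_right := fun f g => rfl }

theorem extensionFunctor_preservesHomology {ι : Type} [Fintype ι] (a : ι → S)
    (ha : ∀ s : S, ∃! c : ι → R, ∑ i, a i * φ (c i) = s) :
    (extensionFunctor φ).PreservesHomology := by
  have := (extensionAdjunction φ).isLeftAdjoint
  have : (extensionFunctor φ).PreservesMonomorphisms := ⟨fun f hf => by
    rw [ModuleCat.mono_iff_injective] at hf ⊢
    exact extensionMap_injective a ha f.hom hf⟩
  exact Functor.preservesHomology_of_preservesMonos_and_cokernels _

/-- The right action of `R` on `Hom_R(S, R)` by endomorphisms over `S`. -/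
noncomputable def coextendScalarsEnd :
    R →+* (End ((ModuleCat.coextendScalars.{u} φ).obj (ModuleCat.of R R)))ᵐᵒᵖ where
  toFun r := MulOpposite.op ((ModuleCat.coextendScalars.{u} φ).map
    (ModuleCat.ofHom (LinearMap.toSpanSingleton R R r)))
  map_one' := MulOpposite.unop_injective
    (ModuleCat.hom_ext (LinearMap.ext fun _ => ModuleCat.CoextendScalars.ext
      (LinearMap.ext fun _ => mul_one _)))
  map_mul' _ _ := MulOpposite.unop_injective
    (ModuleCat.hom_ext (LinearMap.ext fun _ => ModuleCat.CoextendScalars.ext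
      (LinearMap.ext fun _ => (mul_assoc _ _ _).symm)))
  map_zero' := MulOpposite.unop_injective
    (ModuleCat.hom_ext (LinearMap.ext fun _ => ModuleCat.CoextendScalars.ext
      (LinearMap.ext fun _ => mul_zero _)))
  map_add' _ _ := MulOpposite.unop_injective
    (ModuleCat.hom_ext (LinearMap.ext fun _ => ModuleCat.CoextendScalars.ext
      (LinearMap.ext fun _ => mul_add _ _ _)))

/-- The functor `N ↦ Hom_S(Hom_R(S, R), N)`. -/
noncomputable abbrev coextendScalarsRightAdjoint : ModuleCat.{u} S ⥤ ModuleCat.{u} R :=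
  preadditiveCoyonedaObj ((ModuleCat.coextendScalars.{u} φ).obj (ModuleCat.of R R)) ⋙
    ModuleCat.restrictScalars (coextendScalarsEnd φ)

/-- Homs out of a projective object form an exact functor, and restriction of scalars is exact. -/
instance [Projective ((ModuleCat.coextendScalars.{u} φ).obj (ModuleCat.of R R))] :
    (coextendScalarsRightAdjoint φ).PreservesHomology := by
  refine ((Functor.exact_tfae (coextendScalarsRightAdjoint φ)).out 1 2).1 fun K hK => ?_
  exact (hK.map (preadditiveCoyonedaObj _)).map (ModuleCat.restrictScalars (coextendScalarsEnd φ))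

/-- An `R`-linear map `S → M` as an element of `(coextendScalars φ).obj M`. -/
noncomputable abbrev coextMk {M : ModuleCat.{u} R}
    (f : (ModuleCat.restrictScalars φ).obj (ModuleCat.of S S) →ₗ[R] M) :
    (ModuleCat.coextendScalars.{u} φ).obj M :=
  (ModuleCat.CoextendScalars.equiv φ M).symm f

variable {φ} {ι : Type} [Fintype ι]
  (b : Module.Basis ι R ((ModuleCat.restrictScalars φ).obj (ModuleCat.of S S)))

/-- Dual basis expansion, checked on each `b j`. It shows that `Hom_R(S, M)` is generated by images
of `Hom_R(S, R)`, which is what inverts the adjunction map. -/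
theorem coextendScalars_eq_sum_coord {M : ModuleCat.{u} R}
    (u : (ModuleCat.coextendScalars.{u} φ).obj M) :
    ∑ i, (ModuleCat.coextendScalars.{u} φ).map (ModuleCat.ofHom (X := ModuleCat.of R R)
      (LinearMap.toSpanSingleton R M (u (b i)))) (coextMk φ (M := ModuleCat.of R R) (b.coord i)) =
        u := by
  refine ModuleCat.CoextendScalars.ext (b.ext fun j => ?_)
  rw [map_sum, LinearMap.sum_apply, Finset.sum_eq_single j]
  · change b.coord j (b j) • u (b j) = u (b j)
    simp
  · intro i _ hi
    change b.coord i (b j) • u (b i) = 0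
    simp [hi.symm]
  · simp

/-- An `R`-linear map `M → Hom_S(Hom_R(S, R), N)` as a biadditive map. -/
noncomputable def coextendScalarsPairing {M : ModuleCat.{u} R} {N : ModuleCat.{u} S}
    (k : M ⟶ (coextendScalarsRightAdjoint φ).obj N) :
    M →+ ((ModuleCat.coextendScalars.{u} φ).obj (ModuleCat.of R R) →ₗ[S] N) :=
  AddMonoidHom.mk' (fun m => ModuleCat.Hom.hom
    (show (ModuleCat.coextendScalars.{u} φ).obj (ModuleCat.of R R) ⟶ N from k m))
    (fun m m' => by
      rw [map_add]
      rfl)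

theorem coextendScalarsPairing_smul {M : ModuleCat.{u} R} {N : ModuleCat.{u} S}
    (k : M ⟶ (coextendScalarsRightAdjoint φ).obj N) (r : R) (m : M)
    (x : (ModuleCat.coextendScalars.{u} φ).obj (ModuleCat.of R R)) :
    coextendScalarsPairing k (r • m) x =
      coextendScalarsPairing k m ((ModuleCat.coextendScalars.{u} φ).map
        (ModuleCat.ofHom (LinearMap.toSpanSingleton R R r)) x) := by
  change ModuleCat.Hom.hom (show (ModuleCat.coextendScalars.{u} φ).obj (ModuleCat.of R R) ⟶ N
    from k (r • m)) x = _
  rw [map_smul]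
  rfl

theorem sum_coextendScalarsPairing {M : ModuleCat.{u} R} {N : ModuleCat.{u} S}
    (k : M ⟶ (coextendScalarsRightAdjoint φ).obj N) (m : M)
    (x : (ModuleCat.coextendScalars.{u} φ).obj (ModuleCat.of R R)) :
    ∑ i, coextendScalarsPairing k ((show R from x (b i)) • m)
      (coextMk φ (M := ModuleCat.of R R) (b.coord i)) = coextendScalarsPairing k m x := by
  conv_rhs => rw [← coextendScalars_eq_sum_coord b x, map_sum]
  exact Finset.sum_congr rfl fun i _ => coextendScalarsPairing_smul _ _ _ _

/-- The map inverse to `Hom_S(Hom_R(S, M), N) → Hom_R(M, Hom_S(Hom_R(S, R), N))`. -/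
noncomputable def coextendScalarsDesc {M : ModuleCat.{u} R} {N : ModuleCat.{u} S}
    (k : M ⟶ (coextendScalarsRightAdjoint φ).obj N) :
    (ModuleCat.coextendScalars.{u} φ).obj M ⟶ N :=
  ModuleCat.ofHom
    { toFun := fun u => ∑ i, coextendScalarsPairing k (u (b i))
        (coextMk φ (M := ModuleCat.of R R) (b.coord i))
      map_add' := fun u v => by
        rw [← Finset.sum_add_distrib]
        refine Finset.sum_congr rfl fun i _ => ?_
        rw [← LinearMap.add_apply, ← map_add]
        rfl
      map_smul' := fun s u => by
        rw [RingHom.id_apply, Finset.smul_sum]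
        -- Here `(s • u) (b i) = u (b i * s)`, and `b i * s` is expanded in the basis.
        have h : ∀ i, (s • u) (b i) = ∑ j, (show R from
            (s • coextMk φ (M := ModuleCat.of R R) (b.coord j)) (b i)) • u (b j) := by
          intro i
          change u ((show S from b i) * s) = ∑ j, b.coord j ((show S from b i) * s) • u (b j)
          conv_lhs => rw [← b.sum_repr ((show S from b i) * s), map_sum]
          exact Finset.sum_congr rfl fun j _ => map_smul _ _ _
        simp only [h, map_sum, LinearMap.sum_apply]
        rw [Finset.sum_comm]
        refine Finset.sum_congr rfl fun j _ => ?_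
        rw [sum_coextendScalarsPairing, map_smul] }

/-- `Hom_R(S, -)` is left adjoint to `Hom_S(Hom_R(S, R), -)` if `S` is a finite free `R`-module. -/
noncomputable def coextendScalarsAdjunction :
    (ModuleCat.coextendScalars.{u} φ : ModuleCat.{u} R ⥤ ModuleCat.{u} S) ⊣
      coextendScalarsRightAdjoint φ :=
  Adjunction.mkOfHomEquiv
    { homEquiv := fun M N =>
        { toFun := fun h => ModuleCat.ofHom (Y := (coextendScalarsRightAdjoint φ).obj N)
            { toFun := fun m => (ModuleCat.coextendScalars.{u} φ).map (ModuleCat.ofHom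
                (X := ModuleCat.of R R) (LinearMap.toSpanSingleton R M m)) ≫ h
              map_add' := fun m m' => by
                refine ModuleCat.hom_ext (LinearMap.ext fun x => ?_)
                refine (congrArg h.hom ?_).trans (map_add h.hom _ _)
                exact ModuleCat.CoextendScalars.ext (LinearMap.ext fun _ => smul_add _ _ _)
              map_smul' := fun r m => by
                refine ModuleCat.hom_ext (LinearMap.ext fun x => ?_)
                refine congrArg h.hom ?_
                exact ModuleCat.CoextendScalars.ext (LinearMap.ext fun _ => smul_smul _ _ _) }
          invFun := coextendScalarsDesc b
          left_inv := fun h => by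
            refine ModuleCat.hom_ext (LinearMap.ext fun u => ?_)
            refine Eq.trans ?_ (congrArg h.hom (coextendScalars_eq_sum_coord b u))
            rw [map_sum]
            rfl
          right_inv := fun k => by
            refine ModuleCat.hom_ext (LinearMap.ext fun m => ?_)
            refine ModuleCat.hom_ext (LinearMap.ext fun x => ?_)
            exact sum_coextendScalarsPairing b k m x }
      homEquiv_naturality_left_symm := fun f g => rfl
      homEquiv_naturality_right := fun f g => rfl }

/-- `Hom_R(S, -)` is right adjoint to restriction, hence preserves monomorphisms, and is itself a
left adjoint, hence preserves cokernels. -/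
theorem coextendScalars_preservesHomology
    (e : Module.Basis ι R ((ModuleCat.restrictScalars φ).obj (ModuleCat.of S S))) :
    (ModuleCat.coextendScalars.{u} φ :
      ModuleCat.{u} R ⥤ ModuleCat.{u} S).PreservesHomology := by
  have := (coextendScalarsAdjunction e).isLeftAdjoint
  have := (ModuleCat.restrictCoextendScalarsAdj.{u, u, u} φ).isRightAdjoint
  exact Functor.preservesHomology_of_preservesMonos_and_cokernels _

end Adjunctions

/-! ### Normalizing bases -/

section Normalizing

variable {R S : Type u} [Ring R] [Ring S] {φ : R →+* S} {ι : Type} {a : ι → S}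

theorem exists_leftBasis [Fintype ι] (hl : ∀ s : S, ∃! c : ι → R, ∑ i, φ (c i) * a i = s) :
    ∃ b : Module.Basis ι R ((ModuleCat.restrictScalars φ).obj (ModuleCat.of S S)),
      ∀ i, b i = a i := by
  classical
  let f : (ι → R) →ₗ[R] (ModuleCat.restrictScalars φ).obj (ModuleCat.of S S) :=
    Fintype.linearCombination R (fun i => (show (ModuleCat.restrictScalars φ).obj
      (ModuleCat.of S S) from a i))
  have hf : Function.Bijective f := (Function.bijective_iff_existsUnique f).2 hl
  refine ⟨Module.Basis.ofEquivFun (LinearEquiv.ofBijective f hf).symm, fun i => ?_⟩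
  rw [Module.Basis.coe_ofEquivFun]
  change f (Pi.single i 1) = _
  rw [Fintype.linearCombination_apply_single, one_smul]

theorem injective_mul_of_leftBasis [Fintype ι]
    (hl : ∀ s : S, ∃! c : ι → R, ∑ i, φ (c i) * a i = s) (i : ι) :
    Function.Injective (fun r => φ r * a i) := by
  classical
  intro r r' h
  have key : ∀ x : R, ∑ j, φ ((Pi.single i x : ι → R) j) * a j = φ x * a i := fun x => by
    rw [Finset.sum_eq_single i]
    · rw [Pi.single_eq_same]
    · intro j _ hj
      rw [Pi.single_eq_of_ne hj, map_zero, zero_mul]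
    · simp
  exact Pi.single_injective i ((hl _).unique (key r) ((key r').trans h.symm))

theorem injective_mul_of_rightBasis [Fintype ι]
    (hr : ∀ s : S, ∃! c : ι → R, ∑ i, a i * φ (c i) = s) (i : ι) :
    Function.Injective (fun r => a i * φ r) := by
  classical
  intro r r' h
  have key : ∀ x : R, ∑ j, a j * φ ((Pi.single i x : ι → R) j) = a i * φ x := fun x => by
    rw [Finset.sum_eq_single i]
    · rw [Pi.single_eq_same]
    · intro j _ hj
      rw [Pi.single_eq_of_ne hj, map_zero, mul_zero]
    · simp
  exact Pi.single_injective i ((hr _).unique (key r) ((key r').trans h.symm))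

/-- The inclusion `aᵢ R ⊆ R aᵢ` defines `σ`; uniqueness of left coordinates makes it a ring
homomorphism, uniqueness of right coordinates makes it injective, and the reverse inclusion makes it
surjective. -/
theorem exists_normalizing_automorphism [Fintype ι]
    (hn : ∀ i, Set.range (fun r : R => a i * φ r) = Set.range (fun r : R => φ r * a i))
    (hr : ∀ s : S, ∃! c : ι → R, ∑ i, a i * φ (c i) = s)
    (hl : ∀ s : S, ∃! c : ι → R, ∑ i, φ (c i) * a i = s) (i : ι) :
    ∃ σ : R ≃+* R, ∀ r, a i * φ r = φ (σ r) * a i := by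
  have h : ∀ r, ∃ r', φ r' * a i = a i * φ r := fun r => by
    have : a i * φ r ∈ Set.range (fun r : R => φ r * a i) := hn i ▸ ⟨r, rfl⟩
    exact this
  choose σ hσ using h
  have inj := injective_mul_of_leftBasis hl i
  let f : R →+* R :=
    { toFun := σ
      map_one' := inj (by simp only [hσ, map_one, mul_one, one_mul])
      map_mul' := fun x y => inj (by
        simp only [hσ, map_mul]
        rw [mul_assoc (φ (σ x)), hσ, ← mul_assoc, ← mul_assoc, hσ])
      map_zero' := inj (by simp only [hσ, map_zero, mul_zero, zero_mul])
      map_add' := fun x y => inj (by simp only [hσ, map_add, mul_add, add_mul]) }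
  have hf : Function.Bijective f := by
    constructor
    · intro x y hxy
      refine injective_mul_of_rightBasis hr i ?_
      simp only [← hσ]
      exact congrArg (fun r => φ r * a i) hxy
    · intro y
      have : φ y * a i ∈ Set.range (fun r : R => a i * φ r) := hn i ▸ ⟨y, rfl⟩
      obtain ⟨x, hx⟩ := this
      exact ⟨x, inj ((hσ x).trans hx)⟩
  exact ⟨RingEquiv.ofBijective f hf, fun r => (hσ r).symm⟩

/-- The map `S → M` sending the `j`-th basis element to `m` and the other ones to `0`. -/
noncomputable def coextSingle
    (b : Module.Basis ι R ((ModuleCat.restrictScalars φ).obj (ModuleCat.of S S)))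
    (M : ModuleCat.{u} R) (j : ι) : M →+ (ModuleCat.coextendScalars.{u} φ).obj M :=
  AddMonoidHom.mk' (fun m => coextMk φ (LinearMap.toSpanSingleton R M m ∘ₗ b.coord j))
    (fun _ _ => ModuleCat.CoextendScalars.ext (LinearMap.ext fun _ => smul_add _ _ _))

section

variable (b : Module.Basis ι R ((ModuleCat.restrictScalars φ).obj (ModuleCat.of S S)))

theorem sum_coextSingle [Fintype ι] {M : ModuleCat.{u} R}
    (u : (ModuleCat.coextendScalars.{u} φ).obj M) :
    ∑ j, coextSingle b M j (u (b j)) = u :=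
  coextendScalars_eq_sum_coord b u

theorem map_coextSingle {M N : ModuleCat.{u} R} (f : M ⟶ N) (j : ι) (m : M) :
    (ModuleCat.coextendScalars.{u} φ).map f (coextSingle b M j m) = coextSingle b N j (f m) :=
  ModuleCat.CoextendScalars.ext (LinearMap.ext fun _ => map_smul f.hom _ _)

variable {b} {σ : ι → R ≃+* R}

/-- Evaluation at `b i` is `σ i`-semilinear, so over `R` the module `Hom_R(S, M)` is a product of
copies of `M` twisted by the `σ i`. -/
theorem apply_basis_mul (hb : ∀ i, b i = a i)
    (hσ : ∀ i r, a i * φ r = φ (σ i r) * a i)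
    {M : ModuleCat.{u} R} (u : (ModuleCat.coextendScalars.{u} φ).obj M)
    (r : R) (i : ι) : (φ r • u) (b i) = σ i r • u (b i) := by
  rw [hb]
  change u (a i * φ r) = _
  rw [hσ]
  exact map_smul (ModuleCat.CoextendScalars.equiv φ M u) (σ i r)
    (show (ModuleCat.restrictScalars φ).obj (ModuleCat.of S S) from a i)

theorem smul_coextSingle (hb : ∀ i, b i = a i)
    (hσ : ∀ i r, a i * φ r = φ (σ i r) * a i)
    {M : ModuleCat.{u} R} (r : R) (j : ι) (m : M) :
    φ r • coextSingle b M j m = coextSingle b M j (σ j r • m) := by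
  refine ModuleCat.CoextendScalars.ext (b.ext fun i => ?_)
  refine (apply_basis_mul hb hσ _ r i).trans ?_
  change σ i r • b.coord j (b i) • m = b.coord j (b i) • σ j r • m
  classical
  rw [b.coord_apply, b.repr_self, Finsupp.single_apply]
  split_ifs with h
  · rw [h, one_smul, one_smul]
  · rw [zero_smul, zero_smul, smul_zero]

end

/-- Each twist of `R` by an automorphism is again free of rank one, so `Hom_R(S, R)` is free over
`R`; relative projectivity then gives projectivity over `S`. -/
theorem IsExcellentExtension.projective_coextendScalars [Fintype ι] (hφ : IsExcellentExtension φ)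
    {b : Module.Basis ι R ((ModuleCat.restrictScalars φ).obj (ModuleCat.of S S))}
    (hb : ∀ i, b i = a i) {σ : ι → R ≃+* R} (hσ : ∀ i r, a i * φ r = φ (σ i r) * a i) :
    Projective ((ModuleCat.coextendScalars.{u} φ).obj (ModuleCat.of R R)) := by
  classical
  let D := (ModuleCat.coextendScalars.{u} φ).obj (ModuleCat.of R R)
  let _ : Module R D := Module.compHom _ φ
  -- Applying `σ j` to the `j`-th coordinate absorbs the twist and makes the map `R`-linear.
  let f : (ι → R) →ₗ[R] D :=
    { toFun := fun c => ∑ j, coextSingle b (ModuleCat.of R R) j (σ j (c j))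
      map_add' := fun c d => by
        simp only [Pi.add_apply, map_add, Finset.sum_add_distrib]
      map_smul' := fun r c => by
        change _ = φ r • ∑ j, coextSingle b (ModuleCat.of R R) j (σ j (c j))
        rw [Finset.smul_sum]
        refine Finset.sum_congr rfl fun j _ => ?_
        rw [smul_coextSingle hb hσ, Pi.smul_apply, smul_eq_mul, map_mul]
        rfl }
  have hf : ∀ c i, (f c : D) (b i) = σ i (c i) := fun c i => by
    change ModuleCat.CoextendScalars.equiv φ (ModuleCat.of R R)
      (∑ j, coextSingle b (ModuleCat.of R R) j (σ j (c j))) (b i) = _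
    rw [map_sum, LinearMap.sum_apply, Finset.sum_eq_single i]
    · change b.coord i (b i) • σ i (c i) = _
      simp
    · intro j _ hj
      change b.coord j (b i) • σ j (c j) = _
      simp [hj.symm]
    · simp
  have hbij : Function.Bijective f := by
    constructor
    · intro c d h
      funext i
      apply (σ i).injective
      rw [← hf, ← hf, h]
    · intro x
      refine ⟨fun i => (σ i).symm (x (b i)), ModuleCat.CoextendScalars.ext (b.ext fun i => ?_)⟩
      exact (hf _ i).trans ((σ i).apply_symm_apply _)
  have := Module.Projective.of_equiv (LinearEquiv.ofBijective f hbij)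
  have : Module.Projective S D := hφ.projective_of_restrict fun _ _ => rfl
  exact (IsProjective.iff_projective D).1 this

end Normalizing

/-! ### Preservation of totally `𝓕`-acyclic complexes -/

section TotallyAcyclic

variable {R S : Type u} [Ring R] [Ring S] {φ : R →+* S} {ι : Type} [Fintype ι] {a : ι → S}

/-- By adjunction `Hom_S(S ⊗_R T, F)` is `Hom_R(T, F)`, and `F` stays flat over `R`. -/
theorem IsTotallyFAcyclic.extension (hr : ∀ s : S, ∃! c : ι → R, ∑ i, a i * φ (c i) = s)
    (hl : ∀ s : S, ∃! c : ι → R, ∑ i, φ (c i) * a i = s)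
    {T : CochainComplex (ModuleCat.{u} R) ℤ} (hT : IsTotallyFAcyclic T) :
    IsTotallyFAcyclic (((extensionFunctor φ).mapHomologicalComplex (ComplexShape.up ℤ)).obj T) := by
  have := extensionFunctor_preservesHomology φ a hr
  refine ⟨fun i => (extensionAdjunction φ).map_projective _ (hT.projective i),
    Functor.acyclic_mapHomologicalComplex _ _ hT.exact, fun F hF i g => ?_⟩
  have h := hT.hom_exact ((ModuleCat.restrictScalars φ).obj F)
    (IsFlatModule.restrict (φ := φ) a hl (M := (ModuleCat.restrictScalars φ).obj F)
      (fun _ _ => rfl) hF) i ((extensionAdjunction φ).homEquiv _ _ g)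
  constructor
  · intro hg
    have hz : (extensionAdjunction φ).homEquiv (T.X (i - 1)) F 0 = 0 := by
      rw [Adjunction.homEquiv_unit, Functor.map_zero, Limits.comp_zero]
    obtain ⟨k, hk⟩ := h.1 (((extensionAdjunction φ).homEquiv_naturality_left _ _).symm.trans
      ((congrArg ((extensionAdjunction φ).homEquiv _ _) hg).trans hz))
    refine ⟨((extensionAdjunction φ).homEquiv _ _).symm k, ?_⟩
    refine ((extensionAdjunction φ).homEquiv_naturality_left_symm _ _).symm.trans ?_
    exact (congrArg ((extensionAdjunction φ).homEquiv _ _).symm hk).trans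
      (Equiv.symm_apply_apply _ _)
  · rintro ⟨k, rfl⟩
    exact (HomologicalComplex.d_comp_d_assoc _ _ _ _ k).trans Limits.zero_comp

/-- A cocycle on `Hom_R(S, T)` is split into components on twisted copies of `T`. Each extends by
total acyclicity of `T`, and the assembled `R`-linear extension is replaced by an `S`-linear one. -/
theorem IsTotallyFAcyclic.coextension (hφ : IsExcellentExtension φ)
    (hl : ∀ s : S, ∃! c : ι → R, ∑ i, φ (c i) * a i = s)
    {b : Module.Basis ι R ((ModuleCat.restrictScalars φ).obj (ModuleCat.of S S))}
    (hb : ∀ i, b i = a i) {σ : ι → R ≃+* R} (hσ : ∀ i r, a i * φ r = φ (σ i r) * a i)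
    {T : CochainComplex (ModuleCat.{u} R) ℤ} (hT : IsTotallyFAcyclic T) :
    IsTotallyFAcyclic
      (((ModuleCat.coextendScalars.{u} φ).mapHomologicalComplex (ComplexShape.up ℤ)).obj T) := by
  have := coextendScalars_preservesHomology b
  have := hφ.projective_coextendScalars hb hσ
  refine ⟨fun i => (coextendScalarsAdjunction b).map_projective _ (hT.projective i),
    Functor.acyclic_mapHomologicalComplex _ _ hT.exact, fun F hF i g => ?_⟩
  constructor
  · intro hg
    have hflat : ∀ j, IsFlatModule R ((ModuleCat.restrictScalars
        (φ.comp ((σ j).symm : R →+* R))).obj F) := fun j => by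
      refine IsFlatModule.restrict (φ := φ.comp ((σ j).symm : R →+* R)) a (fun s => ?_)
        (M := (ModuleCat.restrictScalars (φ.comp ((σ j).symm : R →+* R))).obj F)
        (fun _ _ => rfl) hF
      -- The `aᵢ` remain a left basis along `φ ∘ σⱼ⁻¹`: the coordinates are only changed by `σ j`.
      obtain ⟨c, hc, hu⟩ := hl s
      refine ⟨fun i => σ j (c i), by simpa using hc, fun d hd => ?_⟩
      funext i
      rw [← hu (fun i => (σ j).symm (d i)) hd, RingEquiv.apply_symm_apply]
    -- The `j`-th component of `g`; twisting the action on `F` by `σⱼ⁻¹` is what makes it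
    -- `R`-linear.
    let gj : ∀ j, T.X i ⟶ (ModuleCat.restrictScalars (φ.comp ((σ j).symm : R →+* R))).obj F :=
      fun j => ModuleCat.ofHom
        (Y := (ModuleCat.restrictScalars (φ.comp ((σ j).symm : R →+* R))).obj F)
        { toFun := fun t => g.hom (coextSingle b (T.X i) j t)
          map_add' := fun t t' => by
            rw [map_add]
            exact map_add g.hom _ _
          map_smul' := fun r t => by
            have := smul_coextSingle hb hσ ((σ j).symm r) j t
            rw [RingEquiv.apply_symm_apply] at this
            rw [← this]
            exact map_smul g.hom _ _ }
    have hk : ∀ j, ∃ k : T.X (i + 1) ⟶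
        (ModuleCat.restrictScalars (φ.comp ((σ j).symm : R →+* R))).obj F,
        T.d i (i + 1) ≫ k = gj j := fun j => by
      refine (hT.hom_exact _ (hflat j) i (gj j)).1 ?_
      refine ModuleCat.hom_ext (LinearMap.ext fun t => ?_)
      change g.hom (coextSingle b (T.X i) j (T.d (i - 1) i t)) = 0
      rw [← map_coextSingle]
      exact LinearMap.congr_fun (congrArg ModuleCat.Hom.hom hg) (coextSingle b _ j t)
    choose k hk using hk
    let U := fun i => (ModuleCat.coextendScalars.{u} φ).obj (T.X i)
    -- The twists cancel: evaluation at `b j` is `σ j`-semilinear and `k j` is `σⱼ⁻¹`-semilinear, so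
    -- `h` is `R`-linear for the untwisted action.
    let h : U (i + 1) →+ F := AddMonoidHom.mk'
      (fun u => ∑ j, (show F from k j (u (b j)))) (fun u v => by
        rw [← Finset.sum_add_distrib]
        exact Finset.sum_congr rfl fun j _ => map_add (k j).hom (u (b j)) (v (b j)))
    obtain ⟨l, hl⟩ := hφ.exists_extension
      ((ModuleCat.coextendScalars.{u} φ).map (T.d i (i + 1))).hom g.hom h
      (fun r u => by
        change ∑ j, (show F from k j ((φ r • u) (b j))) = φ r • ∑ j, (show F from k j (u (b j)))
        rw [Finset.smul_sum]
        refine Finset.sum_congr rfl fun j _ => ?_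
        rw [apply_basis_mul hb hσ]
        refine (map_smul (k j).hom _ _).trans ?_
        change φ ((σ j).symm (σ j r)) • (show F from k j (u (b j))) = _
        rw [RingEquiv.symm_apply_apply])
      (fun u => by
        refine Eq.trans ?_ (congrArg g.hom (sum_coextSingle b u))
        refine Eq.trans ?_ (map_sum g.hom _ _).symm
        refine Finset.sum_congr rfl fun j _ => ?_
        exact LinearMap.congr_fun (congrArg ModuleCat.Hom.hom (hk j)) (u (b j)))
    exact ⟨ModuleCat.ofHom l, ModuleCat.hom_ext hl⟩
  · rintro ⟨k, rfl⟩
    exact (HomologicalComplex.d_comp_d_assoc _ _ _ _ k).trans Limits.zero_comp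

end TotallyAcyclic

/-! ### The two inequalities for the Ding projective dimension -/

theorem mainTheorem11 {R S : Type u} [Ring R] [Ring S]
    [HasDerivedCategory.{w₁} (ModuleCat.{u} R)] [HasDerivedCategory.{w₂} (ModuleCat.{u} S)]
    (φ : R →+* S) (hφ : IsExcellentExtension φ)
    (X : CochainComplex (ModuleCat.{u} R) ℤ) (hX : IsHomologicallyBoundedBelow X) :
    ((∃ Y : CochainComplex (ModuleCat.{u} S) ℤ, IsRHom φ X Y) ∧
      ∀ Y : CochainComplex (ModuleCat.{u} S) ℤ, IsRHom φ X Y → Dpd Y ≤ Dpd X) ∧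
    ((∃ Y : CochainComplex (ModuleCat.{u} S) ℤ, IsDerivedTensor φ X Y) ∧
      ∀ Y : CochainComplex (ModuleCat.{u} S) ℤ, IsDerivedTensor φ X Y → Dpd Y ≤ Dpd X) := by
  obtain ⟨n, a, -, hn, hr, hl⟩ := hφ.free_normalizing
  obtain ⟨b, hb⟩ := exists_leftBasis hl
  choose σ hσ using exists_normalizing_automorphism hn hr hl
  have := extensionFunctor_preservesHomology φ a hr
  have := coextendScalars_preservesHomology b
  -- This projectivity makes the right adjoint of `Hom_R(S, -)` exact, as the transport of
  -- resolutions requires.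
  have := hφ.projective_coextendScalars hb hσ
  refine ⟨⟨⟨_, (isRHom_iff φ X _).2 ⟨Iso.refl _⟩⟩, fun Y hY => ?_⟩,
    ⟨⟨_, (isDerivedTensor_iff φ X _).2 ⟨Iso.refl _⟩⟩, fun Y hY => ?_⟩⟩
  · obtain ⟨e⟩ := (isRHom_iff φ X Y).1 hY
    exact Dpd_le_of_hasFCompleteResolution fun n h => (h.mapHomologicalComplex
      (coextendScalarsAdjunction b) fun T hT => hT.coextension hφ hl hb hσ).of_iso e.symm
  · obtain ⟨e⟩ := (isDerivedTensor_iff φ X Y).1 hY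
    exact Dpd_le_of_hasFCompleteResolution fun n h => (h.mapHomologicalComplex
      (extensionAdjunction φ) fun T hT => hT.extension hr hl).of_iso e.symm
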